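/- Let $\mathcal M$ be a category with two distinguished classes of maps, the weak equivalences $\mathcal W$ and the cofibrations $\mathcal{C}of$; a trivial cofibration is a map in $\mathcal W\cap\mathcal{C}of$, and an object $A$ is cofibrant if the map $0\to A$ from the initial object is a cofibration. The triple $(\mathcal M,\mathcal W,\mathcal{C}of)$ is an (Anderson–Brown–Cisinski) ABC cofibration category if: (CF1) $\mathcal M$ has an initial object $0$, which is cofibrant. Cofibrations are stable under composition. All isomorphisms are weak equivalences, and all isomorphisms with cofibrant domain are trivial cofibrations. (CF2) If two of $f$, $g$, $gf$ are weak equivalences, then so is the third. (CF3) If $i\colon A\to B$ is a cofibration, $A\to C$ is a map, and $A$, $C$ are cofibrant, then the pushout $B\sqcup_A C$ exists and $j\colon C\to B\sqcup_A C$ is a cofibration; if $i$ is a trivial cofibration, then so is $j$. (CF4) Any map $f\colon A\to B$ with $A$ cofibrant factors as $f=rf'$ with $f'$ a cofibration and $r$ a weak equivalence. (CF5) If $f_i\colon A_i\to B_i$ ($i\in I$) is a small set of cofibrations with all $A_i$ cofibrant, then $\coprod A_i$ and $\coprod B_i$ exist and are cofibrant, and $\coprod f_i$ is a cofibration; if all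 $f_i$ are trivial cofibrations, then so is $\coprod f_i$. (CF6) For any sequence of cofibrations $A_0\xrightarrow{a_0}A_1\xrightarrow{a_1}A_2\to\cdots$ with $A_0$ cofibrant, $\operatorname{colim}A_n$ exists and $A_0\to\operatorname{colim}A_n$ is a cofibration; if all $a_n$ are trivial cofibrations, then so is $A_0\to\operatorname{colim}A_n$. Dually, $(\mathcal M,\mathcal W,\mathcal{F}ib)$ is an ABC fibration category if $(\mathcal M^{op},\mathcal W^{op},\mathcal{F}ib^{op})$ is an ABC cofibration category. For a small category $\mathcal D$ and a class $\mathcal A$ of maps of $\mathcal M$, let $\mathcal A^{\mathcal D}$ be the class of those maps $X\to Y$ of the diagram category $\mathcal M^{\mathcal D}$ for which $X_d\to Y_d$ is in $\mathcal A$ for every object $d$ of $\mathcal D$. **Theorem.** Let $\mathcal D$ be a small category. 1. If $(\mathcal M,\mathcal W,\mathcal{C}of)$ is an ABC cofibration category, then $(\mathcal M^{\mathcal D},\mathcal W^{\mathcal D},\mathcal{C}of^{\mathcal D})$ is an ABC cofibration category. 2. If $(\mathcal M,\mathcal W,\mathcal{F}ib)$ is an ABC fibration category, then $(\mathcal M^{\mathcal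 D},\mathcal W^{\mathcal D},\mathcal{F}ib^{\mathcal D})$ is an ABC fibration category. -/

import Mathlib

open CategoryTheory CategoryTheory.Limits Opposite

universe w v u

namespace ABC

section

variable {M : Type u} [Category.{v} M]

/-- `A` is cofibrant if the map from the initial object to `A` is a cofibration. In a category
satisfying the axioms below the choice of the initial object is immaterial. -/
def IsCofibrant (Cof : MorphismProperty M) (A : M) : Prop :=
  ∃ (I : M) (hI : IsInitial I), Cof (hI.to A)

/-- `A` is fibrant if the map from `A` to the terminal object is a fibration. In a category
satisfying the axioms below the choice of the terminal object is immaterial. -/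
def IsFibrant (Fib : MorphismProperty M) (A : M) : Prop :=
  ∃ (T : M) (hT : IsTerminal T), Fib (hT.from A)

/-- `(M, W, Cof)` is an Anderson-Brown-Cisinski cofibration category. The universe `w` is the
one of the small sets that index the sums. -/
structure IsCofibrationCategory (W Cof : MorphismProperty M) : Prop where
  /-- There is an initial object, and it is cofibrant. -/
  exists_initial : ∃ I : M, Nonempty (IsInitial I) ∧ IsCofibrant Cof I
  /-- Cofibrations are stable under composition. -/
  cof_comp : ∀ {X Y Z : M} (f : X ⟶ Y) (g : Y ⟶ Z), Cof f → Cof g → Cof (f ≫ g)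
  /-- Isomorphisms are weak equivalences. -/
  weq_of_isIso : ∀ {X Y : M} (f : X ⟶ Y), IsIso f → W f
  /-- Isomorphisms with cofibrant domain are cofibrations. -/
  cof_of_isIso : ∀ {X Y : M} (f : X ⟶ Y), IsIso f → IsCofibrant Cof X → Cof f
  /-- Two out of three. -/
  two_out_of_three : W.HasTwoOutOfThreeProperty
  /-- Pushout axiom: existence. -/
  hasPushout : ∀ {A B C : M} (f : A ⟶ C) (i : A ⟶ B), Cof i → IsCofibrant Cof A →
    IsCofibrant Cof C → HasPushout f i
  /-- Pushout axiom: pushouts of (trivial) cofibrations. -/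
  pushout : ∀ {A B C P : M} {f : A ⟶ C} {i : A ⟶ B} {j : C ⟶ P} {g : B ⟶ P},
    IsPushout f i j g → Cof i → IsCofibrant Cof A → IsCofibrant Cof C →
      Cof j ∧ (W i → W j)
  /-- Factorization axiom. -/
  factorization : ∀ {A B : M} (f : A ⟶ B), IsCofibrant Cof A →
    ∃ (C : M) (f' : A ⟶ C) (r : C ⟶ B), Cof f' ∧ W r ∧ f' ≫ r = f
  /-- Small sums: existence. -/
  hasCoproduct : ∀ {I : Type w} (A B : I → M) (f : ∀ i, A i ⟶ B i), (∀ i, Cof (f i)) →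
    (∀ i, IsCofibrant Cof (A i)) → HasCoproduct A ∧ HasCoproduct B
  /-- Small sums of (trivial) cofibrations; `s` is the sum of the maps `f i`. -/
  coproduct : ∀ {I : Type w} (A B : I → M) (f : ∀ i, A i ⟶ B i), (∀ i, Cof (f i)) →
    (∀ i, IsCofibrant Cof (A i)) →
    ∀ (a : Cofan A) (b : Cofan B), IsColimit a → IsColimit b →
    ∀ s : a.pt ⟶ b.pt, (∀ i, a.inj i ≫ s = f i ≫ b.inj i) →
      IsCofibrant Cof a.pt ∧ IsCofibrant Cof b.pt ∧ Cof s ∧ ((∀ i, W (f i)) → W s)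
  /-- Countable direct sequences of cofibrations: existence of the colimit. -/
  hasColimit_nat : ∀ (A : ℕ ⥤ M), (∀ n : ℕ, Cof (A.map (homOfLE (Nat.le_succ n)))) →
    IsCofibrant Cof (A.obj 0) → HasColimit A
  /-- Countable compositions of (trivial) cofibrations. -/
  colimit_nat : ∀ (A : ℕ ⥤ M), (∀ n : ℕ, Cof (A.map (homOfLE (Nat.le_succ n)))) →
    IsCofibrant Cof (A.obj 0) → ∀ c : Cocone A, IsColimit c →
      Cof (c.ι.app 0) ∧
        ((∀ n : ℕ, W (A.map (homOfLE (Nat.le_succ n)))) → W (c.ι.app 0))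

/-- `(M, W, Fib)` is an Anderson-Brown-Cisinski fibration category. The universe `w` is the
one of the small sets that index the products. -/
structure IsFibrationCategory (W Fib : MorphismProperty M) : Prop where
  /-- There is a terminal object, and it is fibrant. -/
  exists_terminal : ∃ T : M, Nonempty (IsTerminal T) ∧ IsFibrant Fib T
  /-- Fibrations are stable under composition. -/
  fib_comp : ∀ {X Y Z : M} (f : X ⟶ Y) (g : Y ⟶ Z), Fib f → Fib g → Fib (f ≫ g)
  /-- Isomorphisms are weak equivalences. -/
  weq_of_isIso : ∀ {X Y : M} (f : X ⟶ Y), IsIso f → W f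
  /-- Isomorphisms with fibrant codomain are fibrations. -/
  fib_of_isIso : ∀ {X Y : M} (f : X ⟶ Y), IsIso f → IsFibrant Fib Y → Fib f
  /-- Two out of three. -/
  two_out_of_three : W.HasTwoOutOfThreeProperty
  /-- Pullback axiom: existence. -/
  hasPullback : ∀ {A B C : M} (f : C ⟶ A) (p : B ⟶ A), Fib p → IsFibrant Fib A →
    IsFibrant Fib C → HasPullback f p
  /-- Pullback axiom: pullbacks of (trivial) fibrations. -/
  pullback : ∀ {A B C P : M} {q : P ⟶ C} {g : P ⟶ B} {f : C ⟶ A} {p : B ⟶ A},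
    IsPullback q g f p → Fib p → IsFibrant Fib A → IsFibrant Fib C →
      Fib q ∧ (W p → W q)
  /-- Factorization axiom. -/
  factorization : ∀ {A B : M} (f : A ⟶ B), IsFibrant Fib B →
    ∃ (C : M) (s : A ⟶ C) (f' : C ⟶ B), W s ∧ Fib f' ∧ s ≫ f' = f
  /-- Small products: existence. -/
  hasProduct : ∀ {I : Type w} (A B : I → M) (f : ∀ i, A i ⟶ B i), (∀ i, Fib (f i)) →
    (∀ i, IsFibrant Fib (B i)) → HasProduct A ∧ HasProduct B
  /-- Small products of (trivial) fibrations; `s` is the product of the maps `f i`. -/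
  product : ∀ {I : Type w} (A B : I → M) (f : ∀ i, A i ⟶ B i), (∀ i, Fib (f i)) →
    (∀ i, IsFibrant Fib (B i)) →
    ∀ (a : Fan A) (b : Fan B), IsLimit a → IsLimit b →
    ∀ s : a.pt ⟶ b.pt, (∀ i, s ≫ b.proj i = a.proj i ≫ f i) →
      IsFibrant Fib a.pt ∧ IsFibrant Fib b.pt ∧ Fib s ∧ ((∀ i, W (f i)) → W s)
  /-- Countable inverse sequences of fibrations: existence of the limit. -/
  hasLimit_nat : ∀ (A : ℕᵒᵖ ⥤ M), (∀ n : ℕ, Fib (A.map (homOfLE (Nat.le_succ n)).op)) →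
    IsFibrant Fib (A.obj (op 0)) → HasLimit A
  /-- Countable inverse compositions of (trivial) fibrations. -/
  limit_nat : ∀ (A : ℕᵒᵖ ⥤ M), (∀ n : ℕ, Fib (A.map (homOfLE (Nat.le_succ n)).op)) →
    IsFibrant Fib (A.obj (op 0)) → ∀ c : Cone A, IsLimit c →
      Fib (c.π.app (op 0)) ∧
        ((∀ n : ℕ, W (A.map (homOfLE (Nat.le_succ n)).op)) → W (c.π.app (op 0)))

end

end ABC

/-! All axioms except factorization hold objectwise. The pushouts, sums and sequential colimits
involved exist in each degree, so evaluation preserves them, and each clause reduces to the same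
clause in `M`. Objectwise factorizations `X_d → K_d → B_d` are not natural in `d`, so they are made
functorial by attaching the `K_e` freely: `X'_d` glues a copy of `K_e` to `X_d` for every arrow `e ⟶
d` (`exists_factorization_step`). Then `X_d → X'_d` is a cofibration, but `X'_d → B_d` need not be a
weak equivalence. However, the cell of the identity arrow gives a cofibration `K_d → X'_d` whose
composite to `B_d` is a weak equivalence (`cof_of_isAttaching`). Iterating, `X⁰_d → K⁰_d → X¹_d →
K¹_d → ⋯` shows that the colimit is also that of the `Kⁿ_d`. All of these are weakly equivalent to
`B_d`, so their transition maps are trivial cofibrations, and the colimit maps to `B_d` by a weak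
equivalence (`weq_of_interleaving`). For fibration categories, factorization follows by passing to
`Dᵒᵖ ⥤ Mᵒᵖ`. -/

namespace ABC

/-! ### Objectwise limits and colimits of diagrams -/

section Pointwise

variable {M : Type*} [Category* M] {D : Type*} [Category* D] {J : Type*} [Category* J]

theorem hasColimit_of_evaluation (F : J ⥤ D ⥤ M)
    (h : ∀ d, HasColimit (F ⋙ (evaluation D M).obj d)) : HasColimit F :=
  have : ∀ d, HasColimit (F.flip.obj d) := h
  inferInstance

/-- `M` has only some colimits; existence in every degree makes an arbitrary colimit cocone in the
diagram category an objectwise one. -/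
theorem preservesColimit_evaluation (F : J ⥤ D ⥤ M)
    (h : ∀ d, HasColimit (F ⋙ (evaluation D M).obj d)) (d : D) :
    PreservesColimit F ((evaluation D M).obj d) :=
  have : ∀ d, HasColimit (F.flip.obj d) := h
  inferInstance

theorem hasLimit_of_evaluation (F : J ⥤ D ⥤ M)
    (h : ∀ d, HasLimit (F ⋙ (evaluation D M).obj d)) : HasLimit F :=
  have : ∀ d, HasLimit (F.flip.obj d) := h
  inferInstance

theorem preservesLimit_evaluation (F : J ⥤ D ⥤ M)
    (h : ∀ d, HasLimit (F ⋙ (evaluation D M).obj d)) (d : D) :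
    PreservesLimit F ((evaluation D M).obj d) :=
  have : ∀ d, HasLimit (F.flip.obj d) := h
  inferInstance

theorem hasColimit_span_comp_evaluation {A B C : D ⥤ M} (f : A ⟶ C) (i : A ⟶ B) (d : D)
    (h : HasPushout (f.app d) (i.app d)) :
    HasColimit (span f i ⋙ (evaluation D M).obj d) :=
  have : HasColimit (span (((evaluation D M).obj d).map f) (((evaluation D M).obj d).map i)) := h
  hasColimit_of_iso (spanCompIso ((evaluation D M).obj d) f i)

theorem hasLimit_cospan_comp_evaluation {A B C : D ⥤ M} (f : C ⟶ A) (p : B ⟶ A) (d : D)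
    (h : HasPullback (f.app d) (p.app d)) :
    HasLimit (cospan f p ⋙ (evaluation D M).obj d) :=
  have : HasLimit (cospan (((evaluation D M).obj d).map f) (((evaluation D M).obj d).map p)) := h
  hasLimit_of_iso (cospanCompIso ((evaluation D M).obj d) f p).symm

theorem hasColimit_discrete_comp_evaluation {I : Type*} (A : I → D ⥤ M) (d : D)
    (h : HasCoproduct fun i ↦ (A i).obj d) :
    HasColimit (Discrete.functor A ⋙ (evaluation D M).obj d) :=
  have : HasColimit (Discrete.functor fun i ↦ (A i).obj d) := h
  hasColimit_of_iso (F := Discrete.functor fun i ↦ (A i).obj d)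
    (Discrete.natIso fun _ ↦ Iso.refl _)

theorem hasLimit_discrete_comp_evaluation {I : Type*} (A : I → D ⥤ M) (d : D)
    (h : HasProduct fun i ↦ (A i).obj d) :
    HasLimit (Discrete.functor A ⋙ (evaluation D M).obj d) :=
  have : HasLimit (Discrete.functor fun i ↦ (A i).obj d) := h
  hasLimit_of_iso (F := Discrete.functor fun i ↦ (A i).obj d)
    (Discrete.natIso fun _ ↦ Iso.refl _)

theorem nonempty_isInitial_obj [HasInitial M] {A : D ⥤ M} (hA : IsInitial A) (d : D) :
    Nonempty (IsInitial (A.obj d)) :=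
  ⟨hA.isInitialObj ((evaluation D M).obj d)⟩

theorem nonempty_isTerminal_obj [HasTerminal M] {A : D ⥤ M} (hA : IsTerminal A) (d : D) :
    Nonempty (IsTerminal (A.obj d)) :=
  ⟨hA.isTerminalObj ((evaluation D M).obj d)⟩

theorem hasTwoOutOfThreeProperty_functorCategory (W : MorphismProperty M)
    [W.HasTwoOutOfThreeProperty] : (W.functorCategory D).HasTwoOutOfThreeProperty where
  comp_mem _ _ hf hg d := W.comp_mem _ _ (hf d) (hg d)
  of_postcomp _ _ hg hfg d := W.of_postcomp _ _ (hg d) (hfg d)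
  of_precomp _ _ hf hfg d := W.of_precomp _ _ (hf d) (hfg d)

end Pointwise

/-! ### Simultaneous attachment of cells -/

section Attaching

variable {M : Type*} [Category* M] {J : Type*} {X Y : J → M} {Z P : M}

/-- `P` is obtained from `Z` by gluing each `Y j` along `g j : X j ⟶ Z`. -/
structure IsAttaching (g : ∀ j, X j ⟶ Z) (f : ∀ j, X j ⟶ Y j) (z : Z ⟶ P)
    (y : ∀ j, Y j ⟶ P) : Prop where
  w : ∀ j, g j ≫ z = f j ≫ y j
  hom_ext : ∀ ⦃T : M⦄ ⦃φ ψ : P ⟶ T⦄, z ≫ φ = z ≫ ψ → (∀ j, y j ≫ φ = y j ≫ ψ) → φ = ψ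
  exists_desc : ∀ ⦃T : M⦄ (a : Z ⟶ T) (b : ∀ j, Y j ⟶ T), (∀ j, g j ≫ a = f j ≫ b j) →
    ∃ l : P ⟶ T, z ≫ l = a ∧ ∀ j, y j ≫ l = b j

theorem isAttaching_of_isPushout {g : ∀ j, X j ⟶ Z} {f : ∀ j, X j ⟶ Y j}
    {a : Cofan X} (ha : IsColimit a) {b : Cofan Y} (hb : IsColimit b)
    {s : a.pt ⟶ b.pt} (hs : ∀ j, a.inj j ≫ s = f j ≫ b.inj j)
    {z : Z ⟶ P} {y : b.pt ⟶ P} (h : IsPushout (Cofan.IsColimit.desc ha g) s z y) :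
    IsAttaching g f z (fun j ↦ b.inj j ≫ y) where
  w j := by
    rw [← reassoc_of% hs j, ← h.w, Cofan.IsColimit.fac_assoc]
  hom_ext T φ ψ h₁ h₂ :=
    h.hom_ext h₁ (Cofan.IsColimit.hom_ext hb _ _ fun j ↦ by simpa using h₂ j)
  exists_desc T p q hpq := by
    have w : Cofan.IsColimit.desc ha g ≫ p = s ≫ Cofan.IsColimit.desc hb q :=
      Cofan.IsColimit.hom_ext ha _ _ fun j ↦ by
        rw [Cofan.IsColimit.fac_assoc, reassoc_of% hs j, Cofan.IsColimit.fac, hpq]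
    exact ⟨h.desc p _ w, h.inl_desc _ _ w, fun j ↦ by
      rw [Category.assoc, h.inr_desc, Cofan.IsColimit.fac]⟩

/-- If one of the gluing maps is an isomorphism, its cell can be attached first, and the
remaining ones are then attached to it. -/
theorem IsAttaching.isPushout_of_isIso {g : ∀ j, X j ⟶ Z} {f : ∀ j, X j ⟶ Y j} {z : Z ⟶ P}
    {y : ∀ j, Y j ⟶ P} (h : IsAttaching g f z y) (k : J) [IsIso (g k)]
    {a : Cofan fun j : {j // j ≠ k} ↦ X j} (ha : IsColimit a)
    {b : Cofan fun j : {j // j ≠ k} ↦ Y j} (hb : IsColimit b)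
    {s : a.pt ⟶ b.pt} (hs : ∀ j, a.inj j ≫ s = f j ≫ b.inj j) :
    IsPushout (Cofan.IsColimit.desc ha fun j ↦ g j ≫ inv (g k) ≫ f k) s (y k)
      (Cofan.IsColimit.desc hb fun j ↦ y j) := by
  -- Gluing `Y k` along an isomorphism yields `Y k` itself, so `z` factors through the cell `k`.
  have hk : inv (g k) ≫ f k ≫ y k = z := by simp [← h.w]
  refine IsPushout.mk' ?_ ?_ ?_
  · refine Cofan.IsColimit.hom_ext ha _ _ fun j ↦ ?_
    rw [Cofan.IsColimit.fac_assoc, reassoc_of% hs j, Cofan.IsColimit.fac]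
    simp only [Category.assoc, hk, h.w]
  · intro T φ ψ h₁ h₂
    refine h.hom_ext (by simp only [← hk, Category.assoc, h₁]) fun j ↦ ?_
    by_cases hj : j = k
    · subst hj; exact h₁
    · simpa using b.inj ⟨j, hj⟩ ≫= h₂
  · intro T p q hpq
    classical
    have hpq' : ∀ j : {j // j ≠ k}, g j ≫ inv (g k) ≫ f k ≫ p = f j ≫ b.inj j ≫ q := fun j ↦ by
      have := a.inj j ≫= hpq
      rwa [Cofan.IsColimit.fac_assoc, reassoc_of% hs j, Category.assoc, Category.assoc] at this
    obtain ⟨l, hl₁, hl₂⟩ := h.exists_desc (inv (g k) ≫ f k ≫ p)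
      (fun j ↦ if hj : j = k then eqToHom (by rw [hj]) ≫ p else b.inj ⟨j, hj⟩ ≫ q) (by
        intro j
        by_cases hj : j = k
        · subst hj; simp
        · simpa [hj] using hpq' ⟨j, hj⟩)
    refine ⟨l, by simpa using hl₂ k, Cofan.IsColimit.hom_ext hb _ _ fun j ↦ ?_⟩
    rw [Cofan.IsColimit.fac_assoc, hl₂, dif_neg j.2]

end Attaching

/-! ### Interleaved sequences -/

section Telescope

variable {M : Type*} [Category* M]

variable {A : ℕ ⥤ M} {K : ℕ → M} (a : ∀ n, A.obj n ⟶ K n) (b : ∀ n, K n ⟶ A.obj (n + 1))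
  (hab : ∀ n, a n ≫ b n = A.map (homOfLE (Nat.le_succ n)))

/-- If the transition maps of a sequence `A` factor through objects `K n`, a cocone on `A` induces
one on the sequence of the `K n`. -/
def interleavedCocone (c : Cocone A) :
    Cocone (Functor.ofSequence fun n ↦ b n ≫ a (n + 1)) where
  pt := c.pt
  ι := NatTrans.ofSequence (fun n ↦ b n ≫ c.ι.app (n + 1)) fun n ↦ by
    have hι : a (n + 1) ≫ b (n + 1) ≫ c.ι.app (n + 1 + 1) = c.ι.app (n + 1) := by
      rw [reassoc_of% hab (n + 1), c.w]
    rw [Functor.ofSequence_map_homOfLE_succ]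
    exact (Category.assoc _ _ _).trans ((b n ≫= hι).trans (Category.comp_id _).symm)

/-- A sequence whose transition maps factor through objects `K n` has the same colimit as the
sequence of the `K n`. -/
theorem nonempty_isColimit_interleavedCocone {c : Cocone A} (hc : IsColimit c) :
    Nonempty (IsColimit (interleavedCocone a b hab c)) := by
  have hs : ∀ (s : Cocone (Functor.ofSequence fun n ↦ b n ≫ a (n + 1))) (n : ℕ),
      b n ≫ a (n + 1) ≫ s.ι.app (n + 1) = s.ι.app n := fun s n ↦ by
    have := s.w (homOfLE (Nat.le_add_right n 1))
    rw [Functor.ofSequence_map_homOfLE_succ] at this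
    exact (Category.assoc _ _ _).symm.trans this
  let t (s : Cocone (Functor.ofSequence fun n ↦ b n ≫ a (n + 1))) : Cocone A :=
    { pt := s.pt
      ι := NatTrans.ofSequence (fun n ↦ a n ≫ s.ι.app n) fun n ↦ by
        simp only [Functor.const_obj_obj, Functor.const_obj_map, Category.comp_id]
        rw [← hs s n, ← reassoc_of% hab n] }
  refine ⟨{ desc := fun s ↦ hc.desc (t s), fac := fun s n ↦ ?_, uniq := fun s m hm ↦ ?_ }⟩
  · change (b n ≫ c.ι.app (n + 1)) ≫ hc.desc (t s) = _
    rw [Category.assoc, hc.fac]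
    exact hs s n
  · refine hc.hom_ext fun n ↦ ?_
    -- Each leg of `c` factors through `K n`, so a map out of the colimit is determined by the legs
    -- from the `K n`.
    have hι : c.ι.app n = a n ≫ b n ≫ c.ι.app (n + 1) := by rw [reassoc_of% hab n, c.w]
    have hm' : b n ≫ c.ι.app (n + 1) ≫ m = s.ι.app n := (Category.assoc _ _ _).symm.trans (hm n)
    rw [hc.fac, hι]
    exact ((Category.assoc _ _ _).trans (a n ≫= Category.assoc _ _ _)).trans (a n ≫= hm')

end Telescope

/-! ### Cofibrant objects and cell attachment in a cofibration category -/

namespace IsCofibrationCategory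

variable {M : Type u} [Category.{v} M] {W Cof : MorphismProperty M}

section

variable (h : IsCofibrationCategory.{w} W Cof)

include h

theorem hasInitial : HasInitial M := by
  obtain ⟨I, ⟨hI⟩, -⟩ := h.exists_initial
  exact hI.hasInitial

theorem isCofibrant_of_isInitial {I : M} (hI : IsInitial I) : IsCofibrant Cof I := by
  obtain ⟨J, ⟨hJ⟩, K, hK, hKJ⟩ := h.exists_initial
  have : IsIso (hJ.to I) := isIso_of_isInitial hJ hI _
  refine ⟨K, hK, ?_⟩
  rw [hK.hom_ext (hK.to I) (hK.to J ≫ hJ.to I)]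
  exact h.cof_comp _ _ hKJ (h.cof_of_isIso _ this ⟨K, hK, hKJ⟩)

theorem cof_of_isInitial {I A : M} (hI : IsInitial I) (hA : IsCofibrant Cof A) :
    Cof (hI.to A) := by
  obtain ⟨J, hJ, hJA⟩ := hA
  rw [hI.hom_ext (hI.to A) (hI.to J ≫ hJ.to A)]
  exact h.cof_comp _ _ (h.cof_of_isIso _ (isIso_of_isInitial hI hJ _)
    (h.isCofibrant_of_isInitial hI)) hJA

theorem isCofibrant_of_cof {A B : M} {f : A ⟶ B} (hf : Cof f) (hA : IsCofibrant Cof A) :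
    IsCofibrant Cof B := by
  obtain ⟨J, hJ, hJA⟩ := hA
  refine ⟨J, hJ, ?_⟩
  rw [hJ.hom_ext (hJ.to B) (hJ.to A ≫ f)]
  exact h.cof_comp _ _ hJA hf

theorem isCofibrant_functorCategory_iff {D : Type*} [Category* D] {A : D ⥤ M} :
    IsCofibrant (Cof.functorCategory D) A ↔ ∀ d, IsCofibrant Cof (A.obj d) := by
  have := h.hasInitial
  constructor
  · rintro ⟨I, hI, hIA⟩ d
    obtain ⟨hd⟩ := nonempty_isInitial_obj hI d
    refine ⟨_, hd, ?_⟩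
    rw [hd.hom_ext (hd.to _) ((hI.to A).app d)]
    exact hIA d
  · intro hA
    refine ⟨⊥_ _, initialIsInitial, fun d ↦ ?_⟩
    obtain ⟨hd⟩ := nonempty_isInitial_obj (initialIsInitial (C := D ⥤ M)) d
    rw [hd.hom_ext ((initialIsInitial.to A).app d) (hd.to _)]
    exact h.cof_of_isInitial hd (hA d)

theorem exists_isAttaching {J : Type w} {X Y : J → M} {Z : M} (g : ∀ j, X j ⟶ Z)
    (f : ∀ j, X j ⟶ Y j) (hf : ∀ j, Cof (f j)) (hX : ∀ j, IsCofibrant Cof (X j))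
    (hZ : IsCofibrant Cof Z) :
    ∃ (P : M) (z : Z ⟶ P) (y : ∀ j, Y j ⟶ P), IsAttaching g f z y ∧ Cof z := by
  obtain ⟨_, _⟩ := h.hasCoproduct X Y f hf hX
  have ha := coproductIsCoproduct X
  have hb := coproductIsCoproduct Y
  have hs : ∀ j, (Cofan.mk _ (Sigma.ι X)).inj j ≫ Limits.Sigma.map f =
      f j ≫ (Cofan.mk _ (Sigma.ι Y)).inj j := fun j ↦ by simp
  obtain ⟨hX', -, hs', -⟩ := h.coproduct X Y f hf hX _ _ ha hb (Limits.Sigma.map f) hs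
  have := h.hasPushout (Cofan.IsColimit.desc ha g) (Limits.Sigma.map f) hs' hX' hZ
  have hP := IsPushout.of_hasPushout (Cofan.IsColimit.desc ha g) (Limits.Sigma.map f)
  exact ⟨_, _, _, isAttaching_of_isPushout ha hb hs hP, (h.pushout hP hs' hX' hZ).1⟩

/-- Once the cell `k` has replaced `Z`, the map `y k` is a pushout of the sum of the remaining `f
j`. -/
theorem cof_of_isAttaching {J : Type w} {X Y : J → M} {Z P : M} {g : ∀ j, X j ⟶ Z}
    {f : ∀ j, X j ⟶ Y j} {z : Z ⟶ P} {y : ∀ j, Y j ⟶ P} (hP : IsAttaching g f z y)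
    (hf : ∀ j, Cof (f j)) (hX : ∀ j, IsCofibrant Cof (X j)) (k : J) [IsIso (g k)] :
    Cof (y k) := by
  let X' : {j // j ≠ k} → M := fun j ↦ X j
  let Y' : {j // j ≠ k} → M := fun j ↦ Y j
  let f' : ∀ j, X' j ⟶ Y' j := fun j ↦ f j
  obtain ⟨_, _⟩ := h.hasCoproduct X' Y' f' (fun j ↦ hf j) (fun j ↦ hX j)
  have ha := coproductIsCoproduct X'
  have hb := coproductIsCoproduct Y'
  have hs : ∀ j, (Cofan.mk _ (Sigma.ι X')).inj j ≫ Limits.Sigma.map f' =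
      f' j ≫ (Cofan.mk _ (Sigma.ι Y')).inj j := fun j ↦ by simp
  obtain ⟨hX', -, hs', -⟩ := h.coproduct X' Y' f' (fun j ↦ hf j) (fun j ↦ hX j) _ _ ha hb
    (Limits.Sigma.map f') hs
  exact (h.pushout (hP.isPushout_of_isIso k ha hb hs) hs' hX'
    (h.isCofibrant_of_cof (hf k) (hX k))).1

/-- The maps `K n ⟶ K (n + 1)` are cofibrations between objects weakly equivalent to `B`, hence
trivial. So `K 0 ⟶ c.pt` is a weak equivalence, and two out of three applies to `K 0 ⟶ c.pt ⟶ B`. -/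
theorem weq_of_interleaving {A : ℕ ⥤ M} {c : Cocone A} (hc : IsColimit c) {K : ℕ → M}
    (a : ∀ n, A.obj n ⟶ K n) (b : ∀ n, K n ⟶ A.obj (n + 1))
    (hab : ∀ n, a n ≫ b n = A.map (homOfLE (Nat.le_succ n)))
    (ha : ∀ n, Cof (a n)) (hb : ∀ n, Cof (b n)) (hA : IsCofibrant Cof (A.obj 0))
    {B : M} (q : c.pt ⟶ B) (hq : ∀ n, W (b n ≫ c.ι.app (n + 1) ≫ q)) : W q := by
  have := h.two_out_of_three
  obtain ⟨hc'⟩ := nonempty_isColimit_interleavedCocone a b hab hc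
  have hK := (h.colimit_nat _
    (fun n ↦ by
      rw [Functor.ofSequence_map_homOfLE_succ]
      exact h.cof_comp _ _ (hb n) (ha (n + 1)))
    (h.isCofibrant_of_cof (ha 0) hA) _ hc').2
    (fun n ↦ by
      rw [Functor.ofSequence_map_homOfLE_succ]
      have e : (b n ≫ a (n + 1)) ≫ b (n + 1) ≫ c.ι.app (n + 1 + 1) ≫ q =
          b n ≫ c.ι.app (n + 1) ≫ q := by
        rw [Category.assoc, reassoc_of% hab (n + 1),
          reassoc_of% c.w (homOfLE (Nat.le_succ (n + 1)))]
      exact W.of_postcomp _ _ (hq (n + 1)) (e ▸ hq n))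
  refine W.of_precomp (b 0 ≫ c.ι.app 1) q hK ?_
  rw [Category.assoc]
  exact hq 0

end

/-! ### Factorization of maps of diagrams -/

section Factorization

variable {D : Type w} [SmallCategory.{w} D] (h : IsCofibrationCategory.{w} W Cof)

include h

/-- One step of the construction of factorizations: objectwise factorizations of `X ⟶ B` are
freely attached to `X`. -/
theorem exists_factorization_step {X B : D ⥤ M} (p : X ⟶ B)
    (hX : ∀ d, IsCofibrant Cof (X.obj d)) :
    ∃ (X' : D ⥤ M) (i : X ⟶ X') (p' : X' ⟶ B), i ≫ p' = p ∧ Cof.functorCategory D i ∧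
      ∀ d, ∃ (K : M) (a : X.obj d ⟶ K) (b : K ⟶ X'.obj d),
        Cof a ∧ Cof b ∧ W (b ≫ p'.app d) ∧ a ≫ b = i.app d := by
  choose K a r ha hr har using fun d ↦ h.factorization (p.app d) (hX d)
  choose P z y hP hz using fun d ↦ h.exists_isAttaching (J := Σ e, e ⟶ d)
    (fun j ↦ X.map j.2) (fun j ↦ a j.1) (fun j ↦ ha j.1) (fun j ↦ hX j.1) (hX d)
  -- An arrow `u` sends the cell indexed by `j` to the cell indexed by `j ≫ u`.
  choose m hm₁ hm₂ using fun {d e : D} (u : d ⟶ e) ↦ (hP d).exists_desc (X.map u ≫ z e)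
    (fun j ↦ y e ⟨j.1, j.2 ≫ u⟩) (fun j ↦ by
      simpa using (hP e).w ⟨j.1, j.2 ≫ u⟩)
  choose q hq₁ hq₂ using fun d ↦ (hP d).exists_desc (p.app d) (fun j ↦ r j.1 ≫ B.map j.2)
    (fun j ↦ by simp [reassoc_of% har])
  -- On cells, functoriality of `X'` amounts to the unit and associativity laws for the indexing
  -- arrows.
  have hy : ∀ (d e : D) (u v : e ⟶ d), u = v → y d ⟨e, u⟩ = y d ⟨e, v⟩ := by
    rintro d e u _ rfl; rfl
  let X' : D ⥤ M :=
    { obj := P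
      map := m
      map_id := fun d ↦ (hP d).hom_ext (by simp [hm₁])
        (fun j ↦ by simpa [hm₂] using hy _ _ _ _ (Category.comp_id _))
      map_comp := fun u v ↦ (hP _).hom_ext (by simp [hm₁, reassoc_of% hm₁])
        (fun j ↦ by simpa [hm₂, reassoc_of% hm₂] using hy _ _ _ _ (Category.assoc _ _ _).symm) }
  let i : X ⟶ X' := { app := z, naturality := fun d e u ↦ (hm₁ u).symm }
  let p' : X' ⟶ B :=
    { app := q
      naturality := fun d e u ↦ (hP d).hom_ext
        (by simp [X', hq₁, reassoc_of% hq₁, reassoc_of% hm₁])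
        (fun j ↦ by simp [X', hq₂, reassoc_of% hq₂, reassoc_of% hm₂]) }
  refine ⟨X', i, p', by ext d; exact hq₁ d, hz, fun d ↦ ⟨K d, a d, y d ⟨d, 𝟙 d⟩, ha d, ?_, ?_, ?_⟩⟩
  · exact h.cof_of_isAttaching (hP d) (fun j ↦ ha j.1) (fun j ↦ hX j.1) ⟨d, 𝟙 d⟩
  · have : y d ⟨d, 𝟙 d⟩ ≫ q d = r d := by simp [hq₂]
    change W (y d ⟨d, 𝟙 d⟩ ≫ q d)
    rw [this]
    exact hr d
  · simpa using ((hP d).w ⟨d, 𝟙 d⟩).symm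

theorem hasColimit_nat_functorCategory (A : ℕ ⥤ D ⥤ M)
    (hA : ∀ n : ℕ, Cof.functorCategory D (A.map (homOfLE (Nat.le_succ n))))
    (hA₀ : ∀ d, IsCofibrant Cof ((A.obj 0).obj d)) (d : D) :
    HasColimit (A ⋙ (evaluation D M).obj d) :=
  h.hasColimit_nat _ (fun n ↦ hA n d) (hA₀ d)

theorem exists_factorization_functorCategory {A B : D ⥤ M} (f : A ⟶ B)
    (hA : ∀ d, IsCofibrant Cof (A.obj d)) :
    ∃ (C : D ⥤ M) (f' : A ⟶ C) (r : C ⟶ B),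
      Cof.functorCategory D f' ∧ W.functorCategory D r ∧ f' ≫ r = f := by
  have := h.two_out_of_three
  -- Objectwise cofibrancy is carried along with the map to `B` so that the step can be iterated.
  let S := { X : Over B // ∀ d, IsCofibrant Cof (X.left.obj d) }
  choose X' i p' hip hi K a b ha hb hbp hab using fun s : S ↦
    h.exists_factorization_step s.1.hom s.2
  let next (s : S) : S := ⟨Over.mk (p' s), fun d ↦ h.isCofibrant_of_cof (hi s d) (s.2 d)⟩
  let s : ℕ → S := fun n ↦ n.rec ⟨Over.mk f, hA⟩ fun _ ↦ next
  let F : ℕ ⥤ D ⥤ M := Functor.ofSequence (X := fun n ↦ (s n).1.left) fun n ↦ i (s n)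
  have hF : ∀ n, F.map (homOfLE (Nat.le_succ n)) = i (s n) :=
    Functor.ofSequence_map_homOfLE_succ _
  have hFc : ∀ n, Cof.functorCategory D (F.map (homOfLE (Nat.le_succ n))) := fun n ↦ by
    rw [hF]; exact hi (s n)
  have hFd := h.hasColimit_nat_functorCategory F hFc hA
  have := hasColimit_of_evaluation F hFd
  let t : Cocone F :=
    { pt := B
      ι := NatTrans.ofSequence (fun n ↦ (s n).1.hom) fun n ↦
        ((hF n =≫ _).trans (hip (s n))).trans (Category.comp_id _).symm }
  let r : colimit F ⟶ B := colimit.desc F t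
  have hr : ∀ n, colimit.ι F n ≫ r = (s n).1.hom := colimit.ι_desc t
  refine ⟨colimit F, colimit.ι F 0, r, fun d ↦ ?_, fun d ↦ ?_, hr 0⟩
  all_goals
    have := preservesColimit_evaluation F hFd d
    have hc := isColimitOfPreserves ((evaluation D M).obj d) (colimit.isColimit F)
  · exact (h.colimit_nat _ (fun n ↦ hFc n d) (hA d) _ hc).1
  · have hab' : ∀ n, a (s n) d ≫ b (s n) d =
        (F ⋙ (evaluation D M).obj d).map (homOfLE (Nat.le_succ n)) := fun n ↦ by
      rw [hab, Functor.comp_map, hF]; rfl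
    refine h.weq_of_interleaving hc (fun n ↦ a (s n) d) (fun n ↦ b (s n) d) hab'
      (fun n ↦ ha (s n) d) (fun n ↦ hb (s n) d) (hA d) (r.app d) fun n ↦ ?_
    have e : (colimit.ι F (n + 1)).app d ≫ r.app d = (p' (s n)).app d := congr_app (hr (n + 1)) d
    have := hbp (s n) d
    rw [← e] at this
    exact this

end Factorization

end IsCofibrationCategory

/-! ### Universal cocones and cones evaluated at an object -/

section Evaluation

variable {M : Type*} [Category* M] {D : Type*} [Category* D]

theorem nonempty_isColimit_cofan_evaluation {I : Type*} {A : I → D ⥤ M} {a : Cofan A}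
    (ha : IsColimit a) (d : D) (h : ∀ d, HasCoproduct fun i ↦ (A i).obj d) :
    Nonempty (IsColimit (Cofan.mk (a.pt.obj d) fun i ↦ (a.inj i).app d)) := by
  have := preservesColimit_evaluation (Discrete.functor A)
    (fun d ↦ hasColimit_discrete_comp_evaluation A d (h d)) d
  exact ⟨isColimitCofanMkObjOfIsColimit ((evaluation D M).obj d) A a.inj
    (ha.ofIsoColimit (Cofan.ext (Iso.refl _)))⟩

theorem nonempty_isLimit_fan_evaluation {I : Type*} {A : I → D ⥤ M} {a : Fan A}
    (ha : IsLimit a) (d : D) (h : ∀ d, HasProduct fun i ↦ (A i).obj d) :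
    Nonempty (IsLimit (Fan.mk (a.pt.obj d) fun i ↦ (a.proj i).app d)) := by
  have := preservesLimit_evaluation (Discrete.functor A)
    (fun d ↦ hasLimit_discrete_comp_evaluation A d (h d)) d
  exact ⟨isLimitFanMkObjOfIsLimit ((evaluation D M).obj d) A a.proj
    (ha.ofIsoLimit (Fan.ext (Iso.refl _)))⟩

theorem isPushout_app {A B C P : D ⥤ M} {f : A ⟶ C} {i : A ⟶ B} {j : C ⟶ P} {g : B ⟶ P}
    (sq : IsPushout f i j g) (h : ∀ d, HasPushout (f.app d) (i.app d)) (d : D) :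
    IsPushout (f.app d) (i.app d) (j.app d) (g.app d) := by
  have := preservesColimit_evaluation (span f i)
    (fun d ↦ hasColimit_span_comp_evaluation f i d (h d)) d
  exact sq.map ((evaluation D M).obj d)

theorem isPullback_app {A B C P : D ⥤ M} {q : P ⟶ C} {g : P ⟶ B} {f : C ⟶ A} {p : B ⟶ A}
    (sq : IsPullback q g f p) (h : ∀ d, HasPullback (f.app d) (p.app d)) (d : D) :
    IsPullback (q.app d) (g.app d) (f.app d) (p.app d) := by
  have := preservesLimit_evaluation (cospan f p)
    (fun d ↦ hasLimit_cospan_comp_evaluation f p d (h d)) d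
  exact sq.map ((evaluation D M).obj d)

end Evaluation

/-! ### Cofibration categories of diagrams -/

theorem IsCofibrationCategory.functorCategory {M : Type u} [Category.{v} M]
    {W Cof : MorphismProperty M} (h : IsCofibrationCategory.{w} W Cof)
    (D : Type w) [SmallCategory.{w} D] :
    IsCofibrationCategory.{w} (W.functorCategory D) (Cof.functorCategory D) where
  exists_initial := by
    have := h.hasInitial
    refine ⟨⊥_ _, ⟨initialIsInitial⟩, h.isCofibrant_functorCategory_iff.2 fun d ↦ ?_⟩
    obtain ⟨hd⟩ := nonempty_isInitial_obj (initialIsInitial (C := D ⥤ M)) d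
    exact h.isCofibrant_of_isInitial hd
  cof_comp f g hf hg d := h.cof_comp _ _ (hf d) (hg d)
  weq_of_isIso f hf d := h.weq_of_isIso _ inferInstance
  cof_of_isIso f hf hX d :=
    h.cof_of_isIso _ inferInstance (h.isCofibrant_functorCategory_iff.1 hX d)
  two_out_of_three :=
    have := h.two_out_of_three
    hasTwoOutOfThreeProperty_functorCategory W
  hasPushout f i hi hA hC := by
    rw [h.isCofibrant_functorCategory_iff] at hA hC
    exact hasColimit_of_evaluation _ fun d ↦ hasColimit_span_comp_evaluation f i d
      (h.hasPushout _ _ (hi d) (hA d) (hC d))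
  pushout sq hi hA hC := by
    rw [h.isCofibrant_functorCategory_iff] at hA hC
    have H d := h.pushout (isPushout_app sq
      (fun d ↦ h.hasPushout _ _ (hi d) (hA d) (hC d)) d) (hi d) (hA d) (hC d)
    exact ⟨fun d ↦ (H d).1, fun hW d ↦ (H d).2 (hW d)⟩
  factorization f hA :=
    h.exists_factorization_functorCategory f (h.isCofibrant_functorCategory_iff.1 hA)
  hasCoproduct A B f hf hA := by
    simp only [h.isCofibrant_functorCategory_iff] at hA
    have H d := h.hasCoproduct _ _ (fun i ↦ (f i).app d) (fun i ↦ hf i d) (fun i ↦ hA i d)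
    exact ⟨hasColimit_of_evaluation _ fun d ↦ hasColimit_discrete_comp_evaluation A d (H d).1,
      hasColimit_of_evaluation _ fun d ↦ hasColimit_discrete_comp_evaluation B d (H d).2⟩
  coproduct A B f hf hA a b ha hb s hs := by
    simp only [h.isCofibrant_functorCategory_iff] at hA ⊢
    have H d := h.hasCoproduct _ _ (fun i ↦ (f i).app d) (fun i ↦ hf i d) (fun i ↦ hA i d)
    have H' d := h.coproduct _ _ (fun i ↦ (f i).app d) (fun i ↦ hf i d) (fun i ↦ hA i d) _ _
      (nonempty_isColimit_cofan_evaluation ha d fun d ↦ (H d).1).some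
      (nonempty_isColimit_cofan_evaluation hb d fun d ↦ (H d).2).some (s.app d)
      (fun i ↦ congr_app (hs i) d)
    exact ⟨fun d ↦ (H' d).1, fun d ↦ (H' d).2.1, fun d ↦ (H' d).2.2.1,
      fun hW d ↦ (H' d).2.2.2 fun i ↦ hW i d⟩
  hasColimit_nat A hA hA₀ :=
    hasColimit_of_evaluation _ (h.hasColimit_nat_functorCategory A hA
      (h.isCofibrant_functorCategory_iff.1 hA₀))
  colimit_nat A hA hA₀ c hc := by
    rw [h.isCofibrant_functorCategory_iff] at hA₀
    have := preservesColimit_evaluation A (h.hasColimit_nat_functorCategory A hA hA₀)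
    have H d := h.colimit_nat _ (fun n ↦ hA n d) (hA₀ d) _
      (isColimitOfPreserves ((evaluation D M).obj d) hc)
    exact ⟨fun d ↦ (H d).1, fun hW d ↦ (H d).2 fun n ↦ hW n d⟩

/-! ### Duality and fibration categories of diagrams -/

namespace IsFibrationCategory

variable {M : Type u} [Category.{v} M] {W Fib : MorphismProperty M}

theorem isCofibrant_op_iff {A : Mᵒᵖ} : IsCofibrant Fib.op A ↔ IsFibrant Fib A.unop := by
  constructor
  · rintro ⟨I, hI, h⟩
    refine ⟨I.unop, terminalUnopOfInitial hI, ?_⟩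
    rw [(terminalUnopOfInitial hI).hom_ext ((terminalUnopOfInitial hI).from A.unop) (hI.to A).unop]
    exact h
  · rintro ⟨T, hT, h⟩
    refine ⟨op T, initialOpOfTerminal hT, ?_⟩
    rw [(initialOpOfTerminal hT).hom_ext ((initialOpOfTerminal hT).to A) (hT.from A.unop).op]
    exact h

theorem nonempty_isLimit_fan_unop {I : Type*} {A : I → Mᵒᵖ} {a : Cofan A} (ha : IsColimit a) :
    Nonempty (IsLimit (Fan.mk a.pt.unop fun i ↦ (a.inj i).unop)) :=
  ⟨Fan.IsLimit.mk _ (fun s ↦ (Cofan.IsColimit.desc ha fun i ↦ (s.proj i).op).unop)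
    (fun s i ↦ Quiver.Hom.op_inj (by simp))
    (fun s m hm ↦ Quiver.Hom.op_inj (Cofan.IsColimit.hom_ext ha _ _ fun i ↦
      Quiver.Hom.unop_inj (by simpa using hm i)))⟩

theorem hasCoproduct_of_hasProduct_unop {I : Type*} {A : I → Mᵒᵖ}
    (h : HasProduct fun i ↦ (A i).unop) : HasCoproduct A :=
  have : HasCoproduct fun i ↦ op (A i).unop := inferInstance
  this

variable (h : IsFibrationCategory.{w} W Fib)

include h

/-- The opposite of a fibration category is a cofibration category. -/
theorem op : IsCofibrationCategory.{w} W.op Fib.op where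
  exists_initial := by
    obtain ⟨T, ⟨hT⟩, hT'⟩ := h.exists_terminal
    exact ⟨Opposite.op T, ⟨initialOpOfTerminal hT⟩, isCofibrant_op_iff.2 hT'⟩
  cof_comp f g hf hg := h.fib_comp _ _ hg hf
  weq_of_isIso f hf := h.weq_of_isIso _ inferInstance
  cof_of_isIso f hf hX := h.fib_of_isIso _ inferInstance (isCofibrant_op_iff.1 hX)
  two_out_of_three :=
    have := h.two_out_of_three
    inferInstance
  hasPushout f i hi hA hC := by
    have := h.hasPullback f.unop i.unop hi (isCofibrant_op_iff.1 hA) (isCofibrant_op_iff.1 hC)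
    exact (IsPullback.of_hasPullback f.unop i.unop).op.flip.hasPushout
  pushout sq hi hA hC :=
    h.pullback sq.unop.flip hi (isCofibrant_op_iff.1 hA) (isCofibrant_op_iff.1 hC)
  factorization f hA := by
    obtain ⟨C, s, f', hs, hf', e⟩ := h.factorization f.unop (isCofibrant_op_iff.1 hA)
    exact ⟨Opposite.op C, f'.op, s.op, hf', hs, Quiver.Hom.unop_inj e⟩
  hasCoproduct A B f hf hA := by
    obtain ⟨h₁, h₂⟩ := h.hasProduct _ _ (fun i ↦ (f i).unop) hf
      (fun i ↦ isCofibrant_op_iff.1 (hA i))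
    exact ⟨hasCoproduct_of_hasProduct_unop h₂, hasCoproduct_of_hasProduct_unop h₁⟩
  coproduct A B f hf hA a b ha hb s hs := by
    obtain ⟨h₁, h₂, h₃⟩ := h.product _ _ (fun i ↦ (f i).unop) hf
      (fun i ↦ isCofibrant_op_iff.1 (hA i)) _ _ (nonempty_isLimit_fan_unop hb).some
      (nonempty_isLimit_fan_unop ha).some s.unop (fun i ↦ Quiver.Hom.op_inj (hs i))
    exact ⟨isCofibrant_op_iff.2 h₂, isCofibrant_op_iff.2 h₁, h₃⟩
  hasColimit_nat A hA hA₀ :=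
    have := h.hasLimit_nat A.leftOp hA (isCofibrant_op_iff.1 hA₀)
    hasColimit_of_hasLimit_leftOp A
  colimit_nat A hA hA₀ c hc :=
    h.limit_nat A.leftOp hA (isCofibrant_op_iff.1 hA₀) _ (isLimitConeLeftOpOfCocone A hc)

theorem hasTerminal : HasTerminal M := by
  obtain ⟨T, ⟨hT⟩, -⟩ := h.exists_terminal
  exact hT.hasTerminal

theorem isFibrant_of_isTerminal {T : M} (hT : IsTerminal T) : IsFibrant Fib T :=
  isCofibrant_op_iff.1 (h.op.isCofibrant_of_isInitial (initialOpOfTerminal hT))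

theorem fib_of_isTerminal {T A : M} (hT : IsTerminal T) (hA : IsFibrant Fib A) :
    Fib (hT.from A) := by
  have := h.op.cof_of_isInitial (initialOpOfTerminal hT)
    (isCofibrant_op_iff.2 hA : IsCofibrant _ (.op A))
  rwa [(initialOpOfTerminal hT).hom_ext (IsInitial.to _ _) (hT.from A).op] at this

theorem isFibrant_functorCategory_iff {D : Type*} [Category* D] {A : D ⥤ M} :
    IsFibrant (Fib.functorCategory D) A ↔ ∀ d, IsFibrant Fib (A.obj d) := by
  have := h.hasTerminal
  constructor
  · rintro ⟨T, hT, hTA⟩ d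
    obtain ⟨hd⟩ := nonempty_isTerminal_obj hT d
    refine ⟨_, hd, ?_⟩
    rw [hd.hom_ext (hd.from _) ((hT.from A).app d)]
    exact hTA d
  · intro hA
    refine ⟨⊤_ _, terminalIsTerminal, fun d ↦ ?_⟩
    obtain ⟨hd⟩ := nonempty_isTerminal_obj (terminalIsTerminal (C := D ⥤ M)) d
    rw [hd.hom_ext ((terminalIsTerminal.from A).app d) (hd.from _)]
    exact h.fib_of_isTerminal hd (hA d)

/-- Apply the cofibration case to the opposite transformation between functors `Dᵒᵖ ⥤ Mᵒᵖ`; this is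
the only axiom for diagrams that needs duality rather than an objectwise check. -/
theorem exists_factorization_functorCategory {D : Type w} [SmallCategory.{w} D] {A B : D ⥤ M}
    (f : A ⟶ B) (hB : ∀ d, IsFibrant Fib (B.obj d)) :
    ∃ (C : D ⥤ M) (s : A ⟶ C) (f' : C ⟶ B),
      W.functorCategory D s ∧ Fib.functorCategory D f' ∧ s ≫ f' = f := by
  obtain ⟨C, f', r, hf', hr, e⟩ := h.op.exists_factorization_functorCategory (NatTrans.op f)
    (fun d ↦ isCofibrant_op_iff.2 (hB d.unop))
  refine ⟨C.unop, NatTrans.unop r, NatTrans.unop f', fun d ↦ hr (.op d), fun d ↦ hf' (.op d), ?_⟩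
  ext d
  exact Quiver.Hom.op_inj (congr_app e (.op d))

theorem hasLimit_nat_functorCategory {D : Type*} [Category* D] (A : ℕᵒᵖ ⥤ D ⥤ M)
    (hA : ∀ n : ℕ, Fib.functorCategory D (A.map (homOfLE (Nat.le_succ n)).op))
    (hA₀ : ∀ d, IsFibrant Fib ((A.obj (.op 0)).obj d)) (d : D) :
    HasLimit (A ⋙ (evaluation D M).obj d) :=
  h.hasLimit_nat _ (fun n ↦ hA n d) (hA₀ d)

theorem functorCategory (D : Type w) [SmallCategory.{w} D] :
    IsFibrationCategory.{w} (W.functorCategory D) (Fib.functorCategory D) where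
  exists_terminal := by
    have := h.hasTerminal
    refine ⟨⊤_ _, ⟨terminalIsTerminal⟩, h.isFibrant_functorCategory_iff.2 fun d ↦ ?_⟩
    obtain ⟨hd⟩ := nonempty_isTerminal_obj (terminalIsTerminal (C := D ⥤ M)) d
    exact h.isFibrant_of_isTerminal hd
  fib_comp f g hf hg d := h.fib_comp _ _ (hf d) (hg d)
  weq_of_isIso f hf d := h.weq_of_isIso _ inferInstance
  fib_of_isIso f hf hY d :=
    h.fib_of_isIso _ inferInstance (h.isFibrant_functorCategory_iff.1 hY d)
  two_out_of_three :=
    have := h.two_out_of_three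
    hasTwoOutOfThreeProperty_functorCategory W
  hasPullback f p hp hA hC := by
    rw [h.isFibrant_functorCategory_iff] at hA hC
    exact hasLimit_of_evaluation _ fun d ↦ hasLimit_cospan_comp_evaluation f p d
      (h.hasPullback _ _ (hp d) (hA d) (hC d))
  pullback sq hp hA hC := by
    rw [h.isFibrant_functorCategory_iff] at hA hC
    have H d := h.pullback (isPullback_app sq
      (fun d ↦ h.hasPullback _ _ (hp d) (hA d) (hC d)) d) (hp d) (hA d) (hC d)
    exact ⟨fun d ↦ (H d).1, fun hW d ↦ (H d).2 (hW d)⟩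
  factorization f hB :=
    h.exists_factorization_functorCategory f (h.isFibrant_functorCategory_iff.1 hB)
  hasProduct A B f hf hB := by
    simp only [h.isFibrant_functorCategory_iff] at hB
    have H d := h.hasProduct _ _ (fun i ↦ (f i).app d) (fun i ↦ hf i d) (fun i ↦ hB i d)
    exact ⟨hasLimit_of_evaluation _ fun d ↦ hasLimit_discrete_comp_evaluation A d (H d).1,
      hasLimit_of_evaluation _ fun d ↦ hasLimit_discrete_comp_evaluation B d (H d).2⟩
  product A B f hf hB a b ha hb s hs := by
    simp only [h.isFibrant_functorCategory_iff] at hB ⊢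
    have H d := h.hasProduct _ _ (fun i ↦ (f i).app d) (fun i ↦ hf i d) (fun i ↦ hB i d)
    have H' d := h.product _ _ (fun i ↦ (f i).app d) (fun i ↦ hf i d) (fun i ↦ hB i d) _ _
      (nonempty_isLimit_fan_evaluation ha d fun d ↦ (H d).1).some
      (nonempty_isLimit_fan_evaluation hb d fun d ↦ (H d).2).some (s.app d)
      (fun i ↦ congr_app (hs i) d)
    exact ⟨fun d ↦ (H' d).1, fun d ↦ (H' d).2.1, fun d ↦ (H' d).2.2.1,
      fun hW d ↦ (H' d).2.2.2 fun i ↦ hW i d⟩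
  hasLimit_nat A hA hA₀ :=
    hasLimit_of_evaluation _ (h.hasLimit_nat_functorCategory A hA
      (h.isFibrant_functorCategory_iff.1 hA₀))
  limit_nat A hA hA₀ c hc := by
    rw [h.isFibrant_functorCategory_iff] at hA₀
    have := preservesLimit_evaluation A (h.hasLimit_nat_functorCategory A hA hA₀)
    have H d := h.limit_nat _ (fun n ↦ hA n d) (hA₀ d) _
      (isLimitOfPreserves ((evaluation D M).obj d) hc)
    exact ⟨fun d ↦ (H d).1, fun hW d ↦ (H d).2 fun n ↦ hW n d⟩

end IsFibrationCategory

end ABC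

theorem mainTheorem3 {M : Type u} [Category.{v} M] (W : MorphismProperty M)
    (D : Type w) [SmallCategory.{w} D] :
    (∀ Cof : MorphismProperty M, ABC.IsCofibrationCategory.{w} W Cof →
      ABC.IsCofibrationCategory.{w} (W.functorCategory D) (Cof.functorCategory D)) ∧
    (∀ Fib : MorphismProperty M, ABC.IsFibrationCategory.{w} W Fib →
      ABC.IsFibrationCategory.{w} (W.functorCategory D) (Fib.functorCategory D)) :=
  ⟨fun _ h ↦ h.functorCategory D, fun _ h ↦ h.functorCategory D⟩
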